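/- Let $m,n\ge 1$ be integers, let $X^n$ be a random vector in $\mathbb{R}^n$ (for instance a block of $n$ samples of a real stationary process), let $Z^m$ be a random noise vector in $\mathbb{R}^m$, and let $A\in\mathbb{R}^{m\times n}$ be a random matrix with i.i.d. $\mathcal{N}(0,1)$ entries, independent of the pair $(X^n,Z^m)$. Consider the noisy linear observations $Y^m=AX^n+Z^m$. Assume that the average noise power is at most $\sigma_m^2$ with probability at least $1-\epsilon_m$, i.e. $$\mathbb{P}\Big(\tfrac{1}{\sqrt m}\|Z^m\|_2>\sigma_m\Big)<\epsilon_m .$$ Let $f_n:\mathbb{R}^n\to\{1,2,\ldots,2^{nR}\}$ and $g_n:\{1,2,\ldots,2^{nR}\}\to\mathbb{R}^n$ be the encoder and decoder of a lossy compression code of rate $R$ (if $2^{nR}$ is not an integer, the index set consists of the positive integers not exceeding it), with codebook $\mathcal{C}_n=\{g_n(f_n(x^n)):x^n\in\mathbb{R}^n\}$. Assume that the code achieves distortion $D\in(0,1)$ with excess distortion probability $\epsilon$, i.e. with $\hat X^n=g_n(f_n(X^n))$, $$\mathbb{P}\Big(\tfrac1n\sum_{i=1}^n (X_i-\hat X_i)^2>D\Big)\le\epsilon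 .$$ For arbitrary $\alpha>0$ and $\eta>1$, let $\delta=\frac{\eta}{\log_2(1/D)}+\alpha$, and assume that the number of observations is $m=\frac{2\eta nR}{\log_2(1/D)}$. Let $\tilde X^n$ be a solution of the compressible signal pursuit (CSP) problem, i.e. a minimizer of $\|Y^m-Ax^n\|_2^2$ over $x^n\in\mathcal{C}_n$. Then $$\mathbb{P}\bigg(\frac{1}{\sqrt n}\|X^n-\tilde X^n\|_2\ \ge\ \Big(2+\sqrt{\tfrac nm}\Big)D^{\frac12\left(1-\frac{1+\delta}{\eta}\right)}+\frac{2\sigma_m}{\sqrt{D^{\frac{1+\delta}{\eta}}\,n}}\bigg)\ \le\ \epsilon_m+\epsilon+2^{-\frac12 nR\alpha}+e^{-\frac m2}.$$ -/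

import Mathlib

open MeasureTheory ProbabilityTheory

noncomputable section

/-- A fixed-length lossy compression code of blocklength `n` and rate `R` for real-valued sources:
an encoder into the index set `{1, …, 2 ^ (n R)}` (all integers `k` with `1 ≤ k ≤ 2 ^ (n R)`)
and a decoder from that index set into the reconstruction space. -/
structure LossyCode (n : ℕ) (R : ℝ) where
  /-- the encoding function `f_n` -/
  encode : EuclideanSpace ℝ (Fin n) → Set.Icc 1 ⌊(2 : ℝ) ^ ((n : ℝ) * R)⌋₊
  /-- the decoding function `g_n` -/
  decode : Set.Icc 1 ⌊(2 : ℝ) ^ ((n : ℝ) * R)⌋₊ → EuclideanSpace ℝ (Fin n)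

/-- The average per-letter squared-error distortion between two blocks of length `n`. -/
def avgDistortion {n : ℕ} (x y : EuclideanSpace ℝ (Fin n)) : ℝ :=
  (1 / (n : ℝ)) * ∑ i, (x i - y i) ^ 2

namespace LossyCode

variable {n : ℕ} {R : ℝ}

/-- The reconstruction `g_n (f_n x)` of a block `x`. -/
def reconstruct (C : LossyCode n R) (x : EuclideanSpace ℝ (Fin n)) : EuclideanSpace ℝ (Fin n) :=
  C.decode (C.encode x)

/-- The codebook: the set of all reconstructions that the code can produce. -/
def codebook (C : LossyCode n R) : Set (EuclideanSpace ℝ (Fin n)) :=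
  {c | ∃ x, C.reconstruct x = c}

/-- The code achieves distortion `D` on the random block `X` with excess distortion
probability (at most) `ε`. -/
def AchievesDistortion {Ω : Type*} [MeasurableSpace Ω] (C : LossyCode n R) (μ : Measure Ω)
    (X : Ω → EuclideanSpace ℝ (Fin n)) (D ε : ℝ) : Prop :=
  μ.real {ω | avgDistortion (X ω) (C.reconstruct (X ω)) > D} ≤ ε

/-- `x` is a solution of compressible signal pursuit for the matrix `A` and the observation `y`:
a codeword that minimizes the squared measurement error over the codebook. -/
def IsCSPSolution {m : ℕ} (C : LossyCode n R) (A : Matrix (Fin m) (Fin n) ℝ)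
    (y : EuclideanSpace ℝ (Fin m)) (x : EuclideanSpace ℝ (Fin n)) : Prop :=
  x ∈ C.codebook ∧
    ∀ c ∈ C.codebook, ‖y - Matrix.toEuclideanLin A x‖ ^ 2 ≤ ‖y - Matrix.toEuclideanLin A c‖ ^ 2

end LossyCode

/-- `A` is a random matrix with independent standard normal entries. -/
structure IsStdGaussianMatrix {Ω : Type*} [MeasurableSpace Ω] {m n : ℕ}
    (A : Ω → Matrix (Fin m) (Fin n) ℝ) (μ : Measure Ω) : Prop where
  measurable_entry : ∀ i j, Measurable fun ω => A ω i j
  law_entry : ∀ i j, μ.map (fun ω => A ω i j) = gaussianReal 0 1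
  indep_entries : iIndepFun (fun (p : Fin m × Fin n) ω => A ω p.1 p.2) μ

end

/-!
Condition on the source block `x` and on the noise `z`, and assume that `‖z‖ ≤ √m σ` and that some
codeword `c₀` satisfies `‖x - c₀‖ ≤ τ := √(n D)`; the exceptional events cost `ε_m + ε`. Put
`s = √(D ^ ((1 + δ) / η))`. Recovery fails only if a codeword `c` with
`‖x - c‖ ≥ (2 τ + 2 σ) / s` satisfies `‖A (x - c) + z‖ ≤ ‖A (x - c₀) + z‖`.

For a fixed vector `w`, the vector `A w` is `‖w‖` times a standard Gaussian vector
(`IsStdGaussianMatrix.map_toEuclideanLin`). Hence, for a cut-off `k ≥ 1`, the length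
`‖A (x - c₀)‖` exceeds `√(k m) τ` with probability at most `(√k exp ((1 - k) / 2)) ^ m`, by the
Chernoff bound `stdGaussian_real_norm_sq_ge_le`. Otherwise a standard Gaussian vector lies in a
ball of radius at most `√m s √k / 2` about a point determined by `z` and `c`. As the Gaussian
density is at most `(2 π) ^ (-m / 2)`, the volume of the ball and a Stirling bound for `Gamma` give
`stdGaussian_real_closedBall_le`, whatever the centre. Summing over the at most `2 ^ (n R)`
codewords, and using `2 ^ (n R) * s ^ m = b ^ 2 * 2 ^ (-m / 2)` with `b = 2 ^ (-n R α / 2)`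
(`two_rpow_mul_sqrt_rpow_pow`), the conditional failure probability is at most
`(√k exp ((1 - k) / 2)) ^ m + b ^ 2 (e k / 8) ^ (m / 2) / 2`.

Two savings are essential here. Bounding `‖A (x - c)‖` by the triangle inequality would count the
noise twice and double the radius of the ball; off-centre balls avoid this. And a Chernoff bound
for the balls would lack the factor `1 / 2`. With both, the choice `k = 4` is good enough when
`b ≤ 2 (2 / e) ^ (m / 2)`, and `k = 2` when `b` is larger (`exists_cutoff`).

The encoder need not be measurable, so the average over the source and the noise is taken of an
event that mentions the codebook only, `failureSet`.
-/

/-! ### The standard Gaussian measure of balls and of their complements -/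

theorem MeasureTheory.Measure.pi_le_pi {ι : Type*} [Fintype ι] {α : ι → Type*}
    [∀ i, MeasurableSpace (α i)] {μ ν : ∀ i, Measure (α i)} [∀ i, SigmaFinite (μ i)]
    (h : ∀ i, μ i ≤ ν i) : Measure.pi μ ≤ Measure.pi ν := by
  refine Measure.le_iff.2 fun s hs => ?_
  have hle : (Measure.pi μ).toOuterMeasure ≤
      OuterMeasure.pi fun i => (ν i).toOuterMeasure := by
    rw [OuterMeasure.le_pi]
    intro t _
    change Measure.pi μ (Set.univ.pi t) ≤ ∏ i, ν i (t i)
    rw [Measure.pi_pi]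
    exact Finset.prod_le_prod' fun i _ => h i _
  calc Measure.pi μ s ≤ (OuterMeasure.pi fun i => (ν i).toOuterMeasure) s := hle s
    _ = Measure.pi ν s := by rw [Measure.pi, toMeasure_apply _ _ hs]

theorem gaussianReal_zero_one_le_smul_volume :
    gaussianReal 0 1 ≤ ENNReal.ofReal (√(2 * Real.pi))⁻¹ • (volume : Measure ℝ) := by
  rw [gaussianReal_of_var_ne_zero _ one_ne_zero, ← withDensity_const]
  refine withDensity_mono (ae_of_all _ fun x => ?_)
  refine ENNReal.ofReal_le_ofReal ?_
  rw [gaussianPDFReal]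
  simp only [NNReal.coe_one, mul_one]
  refine mul_le_of_le_one_right (by positivity) (Real.exp_le_one_iff.2 ?_)
  exact div_nonpos_of_nonpos_of_nonneg (neg_nonpos.2 (sq_nonneg _)) (by norm_num)

theorem stdGaussian_le_smul_volume (m : ℕ) :
    stdGaussian (EuclideanSpace ℝ (Fin m)) ≤
      ENNReal.ofReal (√(2 * Real.pi))⁻¹ ^ m • volume := by
  have : SigmaFinite (ENNReal.ofReal (√(2 * Real.pi))⁻¹ • (volume : Measure ℝ)) :=
    SMul.sigmaFinite (μ := (volume : Measure ℝ)) (Real.toNNReal (√(2 * Real.pi))⁻¹)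
  have hpi : (Measure.pi fun _ : Fin m =>
        ENNReal.ofReal (√(2 * Real.pi))⁻¹ • (volume : Measure ℝ)) =
      ENNReal.ofReal (√(2 * Real.pi))⁻¹ ^ m • volume := by
    refine Measure.pi_eq fun s _ => ?_
    simp [volume_pi_pi, Finset.prod_mul_distrib]
  rw [← map_pi_eq_stdGaussian]
  refine (Measure.map_mono (Measure.pi_le_pi fun _ => gaussianReal_zero_one_le_smul_volume)
    (by fun_prop)).trans ?_
  rw [hpi, Measure.map_smul, (PiLp.volume_preserving_toLp (Fin m)).map_eq]

/-- A form of Stirling's lower bound at half-integers, by induction in steps of two. -/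
theorem two_mul_sqrt_pow_le_Gamma (m : ℕ) (hm : 0 < m) :
    2 * √(m / (2 * Real.exp 1)) ^ m ≤ Real.Gamma (m / 2 + 1) := by
  have he := Real.exp_one_gt_d9
  induction m using Nat.twoStepInduction with
  | zero => exact absurd hm (lt_irrefl 0)
  | one =>
    have h1 : Real.Gamma ((1 : ℕ) / 2 + 1) = √Real.pi / 2 := by
      rw [Real.Gamma_add_one (by norm_num)]
      have : ((1 : ℕ) : ℝ) / 2 = 1 / 2 := by norm_num
      rw [this, Real.Gamma_one_half_eq]; ring
    rw [h1, pow_one]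
    have : √((1 : ℕ) / (2 * Real.exp 1)) ≤ √(Real.pi / 16) := by
      refine Real.sqrt_le_sqrt ?_
      rw [div_le_div_iff₀ (by positivity) (by norm_num)]
      have := Real.pi_gt_d2
      push_cast
      nlinarith
    rw [Real.sqrt_div' Real.pi (by norm_num), show (16 : ℝ) = 4 ^ 2 by norm_num,
      Real.sqrt_sq (by norm_num)] at this
    linarith
  | more m ih _ =>
    rcases Nat.eq_zero_or_pos m with rfl | hm0
    · have hG : Real.Gamma (((0 + 2 : ℕ) : ℝ) / 2 + 1) = 1 := by norm_num
      rw [hG, zero_add, Real.sq_sqrt (by positivity), ← mul_div_assoc,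
        div_le_one (by positivity)]
      push_cast
      linarith
    · have ih := ih hm0
      have hm' : (0 : ℝ) < m := by exact_mod_cast hm0
      have hG : Real.Gamma (((m + 2 : ℕ) : ℝ) / 2 + 1) =
          ((m : ℝ) / 2 + 1) * Real.Gamma (m / 2 + 1) := by
        rw [← Real.Gamma_add_one (by positivity)]; push_cast; ring_nf
      have hsq : √(((m + 2 : ℕ) : ℝ) / (2 * Real.exp 1)) ≤
          Real.exp (1 / m) * √(m / (2 * Real.exp 1)) := by
        rw [← Real.sqrt_sq (Real.exp_pos (1 / (m : ℝ))).le, ← Real.sqrt_mul (sq_nonneg _)]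
        refine Real.sqrt_le_sqrt ?_
        rw [← mul_div_assoc]
        gcongr
        have := Real.add_one_le_exp (2 / (m : ℝ))
        rw [← Real.exp_nat_mul]
        have h2 : ((2 : ℕ) : ℝ) * (1 / m) = 2 / m := by push_cast; ring
        rw [h2]
        calc ((m + 2 : ℕ) : ℝ) = (2 / m + 1) * m := by push_cast; field_simp; ring
          _ ≤ _ := by gcongr
      rw [hG, pow_add, Real.sq_sqrt (by positivity)]
      calc 2 * (√(((m + 2 : ℕ) : ℝ) / (2 * Real.exp 1)) ^ m *
            (((m + 2 : ℕ) : ℝ) / (2 * Real.exp 1)))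
          ≤ 2 * ((Real.exp (1 / m) * √(m / (2 * Real.exp 1))) ^ m *
            (((m + 2 : ℕ) : ℝ) / (2 * Real.exp 1))) := by gcongr
        _ = ((m : ℝ) / 2 + 1) * (2 * √(m / (2 * Real.exp 1)) ^ m) := by
            rw [mul_pow, ← Real.exp_nat_mul, mul_one_div_cancel hm'.ne']
            push_cast; field_simp
        _ ≤ _ := by gcongr

/-- Small balls, wherever they are centred, have small Gaussian measure. The factor `1 / 2`
improves on the Chernoff bound. -/
theorem stdGaussian_real_closedBall_le {m : ℕ} (hm : 0 < m) (x : EuclideanSpace ℝ (Fin m))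
    {ρ : ℝ} (hρ : 0 ≤ ρ) :
    (stdGaussian (EuclideanSpace ℝ (Fin m))).real (Metric.closedBall x (√m * ρ)) ≤
      (√(Real.exp 1) * ρ) ^ m / 2 := by
  have : Nonempty (Fin m) := ⟨⟨0, hm⟩⟩
  have hm' : (0 : ℝ) < m := by exact_mod_cast hm
  have hG := two_mul_sqrt_pow_le_Gamma m hm
  have hG0 : 0 < Real.Gamma ((m : ℝ) / 2 + 1) := Real.Gamma_pos_of_pos (by positivity)
  have h := stdGaussian_le_smul_volume m (Metric.closedBall x (√m * ρ))
  rw [Measure.smul_apply, EuclideanSpace.volume_closedBall, Fintype.card_fin, smul_eq_mul,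
    ← ENNReal.ofReal_pow (by positivity), ← ENNReal.ofReal_pow (by positivity),
    ← ENNReal.ofReal_mul (by positivity), ← ENNReal.ofReal_mul (by positivity)] at h
  refine (ENNReal.toReal_le_of_le_ofReal (by positivity) h).trans ?_
  rw [← mul_div_assoc, ← mul_div_assoc, div_le_iff₀ hG0]
  have e1 : √(m / (2 * Real.exp 1)) * √(Real.exp 1) = √m / √2 := by
    rw [← Real.sqrt_mul (by positivity), ← Real.sqrt_div' _ (by norm_num)]
    congr 1; field_simp
  have e2 : (√(2 * Real.pi))⁻¹ * √Real.pi = 1 / √2 := by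
    rw [Real.sqrt_mul (by norm_num)]
    have : √Real.pi ≠ 0 := by positivity
    field_simp
  calc (√(2 * Real.pi))⁻¹ ^ m * ((√m * ρ) ^ m * √Real.pi ^ m)
      = (((√(2 * Real.pi))⁻¹ * √Real.pi) * √m * ρ) ^ m := by simp only [mul_pow]; ring
    _ = (√(m / (2 * Real.exp 1)) * √(Real.exp 1) * ρ) ^ m := by rw [e1, e2]; ring
    _ = (√(Real.exp 1) * ρ) ^ m / 2 * (2 * √(m / (2 * Real.exp 1)) ^ m) := by
      simp only [mul_pow]; ring
    _ ≤ _ := by gcongr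

theorem integrable_exp_mul_sq_gaussianReal {k : ℝ} (hk : 0 < k) :
    Integrable (fun x : ℝ => Real.exp ((1 - 1 / k) / 2 * x ^ 2)) (gaussianReal 0 1) ∧
    ∫ x, Real.exp ((1 - 1 / k) / 2 * x ^ 2) ∂gaussianReal 0 1 = √k := by
  have hpt : ∀ x : ℝ, gaussianPDFReal 0 1 x * Real.exp ((1 - 1 / k) / 2 * x ^ 2) =
      (√(2 * Real.pi))⁻¹ * Real.exp (-(1 / (2 * k)) * x ^ 2) := by
    intro x
    rw [gaussianPDFReal]
    simp only [NNReal.coe_one, mul_one, sub_zero]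
    rw [mul_assoc, ← Real.exp_add]
    congr 2; field_simp; ring
  constructor
  · rw [gaussianReal_of_var_ne_zero _ one_ne_zero,
      integrable_withDensity_iff (measurable_gaussianPDF _ _)
        (ae_of_all _ fun _ => gaussianPDF_lt_top)]
    simp only [toReal_gaussianPDF]
    simp_rw [mul_comm (Real.exp _), hpt]
    exact (integrable_exp_neg_mul_sq (by positivity)).const_mul _
  · rw [integral_gaussianReal_eq_integral_smul one_ne_zero]
    simp_rw [smul_eq_mul, hpt]
    rw [integral_const_mul, integral_gaussian, ← Real.sqrt_inv, ← Real.sqrt_mul (by positivity)]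
    congr 1
    field_simp

/-- The Chernoff bound for the upper tail of a chi-squared variable with `m` degrees of freedom. -/
theorem stdGaussian_real_norm_sq_ge_le (m : ℕ) {k : ℝ} (hk : 1 ≤ k) :
    (stdGaussian (EuclideanSpace ℝ (Fin m))).real {x | k * m ≤ ‖x‖ ^ 2} ≤
      (√k * Real.exp ((1 - k) / 2)) ^ m := by
  have hk0 : 0 < k := by linarith
  obtain ⟨hi, he⟩ := integrable_exp_mul_sq_gaussianReal hk0
  set t := (1 - 1 / k) / 2 with ht
  have ht0 : 0 ≤ t := by
    have : 1 / k ≤ 1 := (div_le_one hk0).2 hk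
    rw [ht]; linarith
  have hprod : (fun x : Fin m → ℝ => Real.exp (t * ‖WithLp.toLp 2 x‖ ^ 2)) =
      fun x => ∏ i, Real.exp (t * x i ^ 2) := by
    funext x
    rw [EuclideanSpace.real_norm_sq_eq, Finset.mul_sum, Real.exp_sum]
  have hmeas : Measurable (WithLp.toLp 2 : (Fin m → ℝ) → EuclideanSpace ℝ (Fin m)) := by fun_prop
  rw [← map_pi_eq_stdGaussian, map_measureReal_apply hmeas
    (measurableSet_le measurable_const (by fun_prop))]
  have hint : Integrable (fun x : Fin m → ℝ => Real.exp (t * ‖WithLp.toLp 2 x‖ ^ 2))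
      (Measure.pi fun _ => gaussianReal 0 1) := by
    rw [hprod]; exact Integrable.fintype_prod fun _ => hi
  refine (measure_ge_le_exp_mul_mgf (k * m) ht0 hint).trans_eq ?_
  rw [mgf, hprod, integral_fintype_prod_eq_prod (fun _ x => Real.exp (t * x ^ 2))]
  simp only [he, Finset.prod_const, Finset.card_univ, Fintype.card_fin]
  rw [mul_pow, ← Real.exp_nat_mul, mul_comm]
  congr 2
  rw [ht]; field_simp; ring

/-! ### Gaussian matrices acting on fixed vectors -/

theorem IsStdGaussianMatrix.measurable_toEuclideanLin {Ω : Type*} [MeasurableSpace Ω]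
    {μ : Measure Ω} {m n : ℕ} {A : Ω → Matrix (Fin m) (Fin n) ℝ} (hA : IsStdGaussianMatrix A μ)
    (w : EuclideanSpace ℝ (Fin n)) :
    Measurable fun ω => Matrix.toEuclideanLin (A ω) w := by
  have : (fun ω => Matrix.toEuclideanLin (A ω) w) =
      fun ω => WithLp.toLp 2 fun i => ∑ j, A ω i j * w j := by
    funext ω
    ext i
    simp [Matrix.toLpLin_apply, Matrix.mulVec, dotProduct]
  rw [this]
  refine (by fun_prop : Measurable (WithLp.toLp 2 : (Fin m → ℝ) → _)).comp
    (measurable_pi_lambda _ fun i => ?_)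
  exact Finset.measurable_sum _ fun j _ => (hA.measurable_entry i j).mul_const _

/-- The image of a fixed vector `w` under a standard Gaussian matrix is `‖w‖` times a standard
Gaussian vector; this is read off from the characteristic functions. -/
theorem IsStdGaussianMatrix.map_toEuclideanLin {Ω : Type*} [MeasurableSpace Ω] {μ : Measure Ω}
    [IsProbabilityMeasure μ] {m n : ℕ} {A : Ω → Matrix (Fin m) (Fin n) ℝ}
    (hA : IsStdGaussianMatrix A μ) (w : EuclideanSpace ℝ (Fin n)) :
    μ.map (fun ω => Matrix.toEuclideanLin (A ω) w) =
      (stdGaussian (EuclideanSpace ℝ (Fin m))).map (fun g => ‖w‖ • g) := by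
  have hmeas := hA.measurable_toEuclideanLin w
  have : IsProbabilityMeasure (μ.map fun ω => Matrix.toEuclideanLin (A ω) w) :=
    Measure.isProbabilityMeasure_map hmeas.aemeasurable
  have hvec : Measurable fun ω (p : Fin m × Fin n) => A ω p.1 p.2 :=
    measurable_pi_lambda _ fun p => hA.measurable_entry p.1 p.2
  have htoLp : Measurable (WithLp.toLp 2 : (Fin m × Fin n → ℝ) → _) := by fun_prop
  have hent : Measurable fun ω => (WithLp.toLp 2 fun p : Fin m × Fin n => A ω p.1 p.2 :
      EuclideanSpace ℝ (Fin m × Fin n)) := htoLp.comp hvec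
  have hlaw : μ.map (fun ω => (WithLp.toLp 2 fun p : Fin m × Fin n => A ω p.1 p.2 :
      EuclideanSpace ℝ (Fin m × Fin n))) = stdGaussian _ := by
    have h1 := (iIndepFun_iff_map_fun_eq_pi_map
      (fun p : Fin m × Fin n => (hA.measurable_entry p.1 p.2).aemeasurable)).1 hA.indep_entries
    simp only [hA.law_entry] at h1
    rw [← map_pi_eq_stdGaussian, ← h1]
    exact (Measure.map_map htoLp hvec).symm
  refine Measure.ext_of_charFun (funext fun t => ?_)
  rw [charFun_map_smul, charFun_stdGaussian]
  -- The vector of all products `t i * w j` turns `⟪A w, t⟫` into an inner product with `A`.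
  let c : EuclideanSpace ℝ (Fin m × Fin n) := WithLp.toLp 2 fun p => t p.1 * w p.2
  have hc : charFun (μ.map fun ω => Matrix.toEuclideanLin (A ω) w) t =
      charFun (stdGaussian (EuclideanSpace ℝ (Fin m × Fin n))) c := by
    rw [← hlaw, charFun_apply, charFun_apply, integral_map hmeas.aemeasurable (by fun_prop),
      integral_map hent.aemeasurable (by fun_prop)]
    congr 1
    funext ω
    congr 3
    simp only [PiLp.inner_apply, c, Fintype.sum_prod_type]
    refine Finset.sum_congr rfl fun i _ => ?_
    simp [Matrix.toLpLin_apply, Matrix.mulVec, dotProduct, Finset.mul_sum]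
    exact Finset.sum_congr rfl fun j _ => by ring
  have hnorm : ‖c‖ ^ 2 = ‖‖w‖ • t‖ ^ 2 := by
    rw [norm_smul, mul_pow, norm_norm]
    simp only [EuclideanSpace.real_norm_sq_eq, c, Fintype.sum_prod_type, Finset.sum_mul_sum, mul_pow]
    rw [Finset.sum_comm]
    exact Finset.sum_congr rfl fun j _ => Finset.sum_congr rfl fun i _ => mul_comm _ _
  rw [hc, charFun_stdGaussian]
  congr 3
  exact_mod_cast hnorm

theorem IsStdGaussianMatrix.real_preimage_toEuclideanLin {Ω : Type*} [MeasurableSpace Ω]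
    {μ : Measure Ω} [IsProbabilityMeasure μ] {m n : ℕ} {A : Ω → Matrix (Fin m) (Fin n) ℝ}
    (hA : IsStdGaussianMatrix A μ) (w : EuclideanSpace ℝ (Fin n))
    {S : Set (EuclideanSpace ℝ (Fin m))} (hS : MeasurableSet S) :
    μ.real {ω | Matrix.toEuclideanLin (A ω) w ∈ S} =
      (stdGaussian (EuclideanSpace ℝ (Fin m))).real {g | ‖w‖ • g ∈ S} := by
  have h := congrArg (fun ν => ν.real S) (hA.map_toEuclideanLin w)
  simp only [map_measureReal_apply (hA.measurable_toEuclideanLin w) hS,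
    map_measureReal_apply (measurable_const_smul ‖w‖) hS] at h
  exact h

theorem IsStdGaussianMatrix.real_norm_sq_ge_le {Ω : Type*} [MeasurableSpace Ω]
    {μ : Measure Ω} [IsProbabilityMeasure μ] {m n : ℕ} {A : Ω → Matrix (Fin m) (Fin n) ℝ}
    (hA : IsStdGaussianMatrix A μ) {v : EuclideanSpace ℝ (Fin n)} {τ k : ℝ} (hτ : 0 < τ)
    (hv : ‖v‖ ≤ τ) (hk : 1 ≤ k) :
    μ.real {ω | k * m * τ ^ 2 ≤ ‖Matrix.toEuclideanLin (A ω) v‖ ^ 2} ≤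
      (√k * Real.exp ((1 - k) / 2)) ^ m := by
  have h := hA.real_preimage_toEuclideanLin v (S := {y | k * m * τ ^ 2 ≤ ‖y‖ ^ 2})
    (measurableSet_le measurable_const (by fun_prop))
  refine h.trans_le (le_trans (measureReal_mono fun g hg => ?_)
    (stdGaussian_real_norm_sq_ge_le m hk))
  simp only [Set.mem_ofPred_eq, norm_smul, norm_norm, mul_pow] at hg ⊢
  have h2 : ‖v‖ ^ 2 * ‖g‖ ^ 2 ≤ ‖g‖ ^ 2 * τ ^ 2 := by
    rw [mul_comm]; gcongr
  exact le_of_mul_le_mul_right (hg.trans h2) (by positivity)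

theorem IsStdGaussianMatrix.real_norm_add_le_le {Ω : Type*} [MeasurableSpace Ω]
    {μ : Measure Ω} [IsProbabilityMeasure μ] {m n : ℕ} (hm : 0 < m)
    {A : Ω → Matrix (Fin m) (Fin n) ℝ} (hA : IsStdGaussianMatrix A μ)
    {w : EuclideanSpace ℝ (Fin n)} (hw : 0 < ‖w‖) (z : EuclideanSpace ℝ (Fin m)) {ρ r : ℝ}
    (hρ : 0 ≤ ρ) (hr : r ≤ √m * (ρ * ‖w‖)) :
    μ.real {ω | ‖Matrix.toEuclideanLin (A ω) w + z‖ ≤ r} ≤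
      (√(Real.exp 1) * ρ) ^ m / 2 := by
  have h := hA.real_preimage_toEuclideanLin w (S := {y | ‖y + z‖ ≤ r})
    (measurableSet_le (by fun_prop) measurable_const)
  refine h.trans_le (le_trans (measureReal_mono fun g hg => ?_)
    (stdGaussian_real_closedBall_le hm (-(‖w‖⁻¹ • z)) hρ))
  simp only [Set.mem_ofPred_eq] at hg
  rw [mem_closedBall_iff_norm, sub_neg_eq_add]
  have e : ‖w‖ • g + z = ‖w‖ • (g + ‖w‖⁻¹ • z) := by
    rw [smul_add, smul_inv_smul₀ hw.ne']
  rw [e, norm_smul, norm_norm] at hg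
  refine le_of_mul_le_mul_left ?_ hw
  calc _ ≤ r := hg
    _ ≤ _ := hr
    _ = _ := by ring

/-! ### The failure probability for a fixed source block and a fixed noise vector -/

/-- Some far element of a finite set `K` can explain the observation as well as a near point `c₀`
only if `A (x - c₀)` is atypically long, or if `A (x - c) + z` falls into a small ball for some
`c ∈ K`. Since the ball need not be centred at the origin, the noise enters its radius only
once. -/
theorem IsStdGaussianMatrix.real_exists_far_le {Ω : Type*} [MeasurableSpace Ω]
    {μ : Measure Ω} [IsProbabilityMeasure μ] {m n : ℕ} (hm : 0 < m)
    {A : Ω → Matrix (Fin m) (Fin n) ℝ} (hA : IsStdGaussianMatrix A μ)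
    (K : Finset (EuclideanSpace ℝ (Fin n))) {x c₀ : EuclideanSpace ℝ (Fin n)}
    {z : EuclideanSpace ℝ (Fin m)} {τ σ s k : ℝ} (hτ : 0 < τ) (hσ : 0 ≤ σ) (hs : 0 < s)
    (hk : 1 ≤ k) (hx : ‖x - c₀‖ ≤ τ) (hz : ‖z‖ ≤ √m * σ) :
    μ.real {ω | ∃ c ∈ K, (2 * τ + 2 * σ) / s ≤ ‖x - c‖ ∧
        ‖Matrix.toEuclideanLin (A ω) (x - c) + z‖ ≤
          ‖Matrix.toEuclideanLin (A ω) (x - c₀) + z‖} ≤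
      (√k * Real.exp ((1 - k) / 2)) ^ m +
        K.card * ((√(Real.exp 1) * (s * √k / 2)) ^ m / 2) := by
  classical
  set K' := K.filter fun c => (2 * τ + 2 * σ) / s ≤ ‖x - c‖ with hK'
  set q := (√(Real.exp 1) * (s * √k / 2)) ^ m / 2 with hq
  have hq0 : 0 ≤ q := by positivity
  have hk' : 1 ≤ √k := Real.one_le_sqrt.2 hk
  have hk0 : 0 ≤ k := by linarith
  have hsub : {ω | ∃ c ∈ K, (2 * τ + 2 * σ) / s ≤ ‖x - c‖ ∧
        ‖Matrix.toEuclideanLin (A ω) (x - c) + z‖ ≤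
          ‖Matrix.toEuclideanLin (A ω) (x - c₀) + z‖} ⊆
      {ω | k * m * τ ^ 2 ≤ ‖Matrix.toEuclideanLin (A ω) (x - c₀)‖ ^ 2} ∪
      ⋃ c ∈ K', {ω | ‖Matrix.toEuclideanLin (A ω) (x - c) + z‖ ≤ √m * (√k * τ + σ)} := by
    rintro ω ⟨c, hc, hfar, hle⟩
    by_cases hlong : k * m * τ ^ 2 ≤ ‖Matrix.toEuclideanLin (A ω) (x - c₀)‖ ^ 2
    · exact Or.inl hlong
    · refine Or.inr (Set.mem_biUnion (Finset.mem_filter.2 ⟨hc, hfar⟩) ?_)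
      have h1 : ‖Matrix.toEuclideanLin (A ω) (x - c₀)‖ ≤ √m * (√k * τ) := by
        refine le_of_sq_le_sq ?_ (by positivity)
        rw [mul_pow, mul_pow, Real.sq_sqrt (by positivity), Real.sq_sqrt hk0]
        linarith
      calc _ ≤ _ := hle
        _ ≤ _ := norm_add_le _ _
        _ ≤ √m * (√k * τ) + √m * σ := add_le_add h1 hz
        _ = _ := by ring
  have hball : ∀ c ∈ K', μ.real {ω | ‖Matrix.toEuclideanLin (A ω) (x - c) + z‖ ≤
      √m * (√k * τ + σ)} ≤ q := by
    intro c hc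
    have hfar := (Finset.mem_filter.1 hc).2
    refine hA.real_norm_add_le_le hm (lt_of_lt_of_le (by positivity) hfar) z (by positivity) ?_
    refine mul_le_mul_of_nonneg_left ?_ (Real.sqrt_nonneg _)
    calc √k * τ + σ ≤ √k * (τ + σ) := by nlinarith
      _ = s * √k / 2 * ((2 * τ + 2 * σ) / s) := by field_simp
      _ ≤ _ := by gcongr
  calc _ ≤ _ := measureReal_mono hsub
    _ ≤ _ := measureReal_union_le _ _
    _ ≤ (√k * Real.exp ((1 - k) / 2)) ^ m + K.card * q := by
      refine add_le_add (hA.real_norm_sq_ge_le hτ hx hk) ?_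
      refine (measureReal_biUnion_finset_le _ _).trans ((Finset.sum_le_sum hball).trans ?_)
      rw [Finset.sum_const, nsmul_eq_mul]
      exact mul_le_mul_of_nonneg_right
        (by exact_mod_cast Finset.card_le_card (Finset.filter_subset _ _)) hq0

/-! ### Averaging over the source and the noise -/

theorem ProbabilityTheory.IndepFun.real_mem_le_of_forall {Ω α β : Type*} [MeasurableSpace Ω]
    [MeasurableSpace α] [MeasurableSpace β] {μ : Measure Ω} [IsProbabilityMeasure μ] {U : Ω → α}
    {V : Ω → β} (hU : Measurable U) (hV : Measurable V) (hUV : IndepFun U V μ)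
    {B : Set (α × β)} (hB : MeasurableSet B) {q : ℝ}
    (h : ∀ v, μ.real {ω | (U ω, v) ∈ B} ≤ q) : μ.real {ω | (U ω, V ω) ∈ B} ≤ q := by
  have hVp : IsProbabilityMeasure (μ.map V) := Measure.isProbabilityMeasure_map hV.aemeasurable
  have hUp : IsProbabilityMeasure (μ.map U) := Measure.isProbabilityMeasure_map hU.aemeasurable
  obtain ⟨ω₀⟩ : Nonempty Ω := nonempty_of_isProbabilityMeasure μ
  have hq : 0 ≤ q := measureReal_nonneg.trans (h (V ω₀))
  refine ENNReal.toReal_le_of_le_ofReal hq ?_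
  have e : μ {ω | (U ω, V ω) ∈ B} = (μ.map fun ω => (U ω, V ω)) B :=
    (Measure.map_apply (hU.prodMk hV) hB).symm
  rw [e, (indepFun_iff_map_prod_eq_prod_map_map hU.aemeasurable hV.aemeasurable).1 hUV,
    Measure.prod_apply_symm hB]
  calc ∫⁻ v, (μ.map U) ((fun u => (u, v)) ⁻¹' B) ∂μ.map V
      ≤ ∫⁻ _, ENNReal.ofReal q ∂μ.map V := by
        refine lintegral_mono fun v => ?_
        rw [Measure.map_apply hU (hB.preimage (by fun_prop))]
        exact (ENNReal.le_ofReal_iff_toReal_le (measure_ne_top _ _) hq).2 (h v)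
    _ = ENNReal.ofReal q := by simp

/-! ### The codebook -/

theorem LossyCode.codebook_eq_image {n : ℕ} {R : ℝ} (C : LossyCode n R) :
    C.codebook = C.decode '' Set.range C.encode := by
  ext c
  simp [LossyCode.codebook, LossyCode.reconstruct]

theorem LossyCode.finite_codebook {n : ℕ} {R : ℝ} (C : LossyCode n R) : C.codebook.Finite := by
  rw [C.codebook_eq_image]
  exact (Set.toFinite _).image _

theorem LossyCode.card_codebook_le {n : ℕ} {R : ℝ} (C : LossyCode n R) :
    (C.finite_codebook.toFinset.card : ℝ) ≤ 2 ^ ((n : ℝ) * R) := by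
  have h : C.finite_codebook.toFinset.card ≤ ⌊(2 : ℝ) ^ ((n : ℝ) * R)⌋₊ := by
    rw [← Set.ncard_eq_toFinset_card _ C.finite_codebook, C.codebook_eq_image]
    calc _ ≤ (Set.range C.encode).ncard := Set.ncard_image_le (Set.toFinite _)
      _ ≤ (Set.univ : Set (Set.Icc 1 ⌊(2 : ℝ) ^ ((n : ℝ) * R)⌋₊)).ncard :=
        Set.ncard_le_ncard (Set.subset_univ _) (Set.toFinite _)
      _ = _ := by rw [Set.ncard_univ]; simp
  exact (Nat.cast_le.2 h).trans (Nat.floor_le (by positivity))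

theorem norm_sub_le_of_avgDistortion_le {n : ℕ} (hn : 0 < n) {x y : EuclideanSpace ℝ (Fin n)}
    {D : ℝ} (h : avgDistortion x y ≤ D) : ‖x - y‖ ≤ √(n * D) := by
  refine Real.le_sqrt_of_sq_le ?_
  have hn' : (0 : ℝ) < n := by exact_mod_cast hn
  rw [avgDistortion, one_div, inv_mul_le_iff₀ hn'] at h
  simpa [EuclideanSpace.real_norm_sq_eq] using h

/-! ### The failure event for random source and noise -/

theorem measurable_toEuclideanLin_of {m n : ℕ} {α : Type*} [MeasurableSpace α]
    {a : α → Fin m → Fin n → ℝ} {w : α → EuclideanSpace ℝ (Fin n)}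
    (ha : Measurable a) (hw : Measurable w) :
    Measurable fun p => Matrix.toEuclideanLin (Matrix.of (a p)) (w p) := by
  have : (fun p => Matrix.toEuclideanLin (Matrix.of (a p)) (w p)) =
      fun p => WithLp.toLp 2 fun i => ∑ j, a p i j * w p j := by
    funext p
    ext i
    simp [Matrix.toLpLin_apply, Matrix.mulVec, dotProduct]
  rw [this]
  refine (by fun_prop : Measurable (WithLp.toLp 2 : (Fin m → ℝ) → _)).comp
    (measurable_pi_lambda _ fun i => ?_)
  exact Finset.measurable_sum _ fun j _ => by fun_prop

/-- The triples `(a, x, z)` for which recovery from a finite set `K` may fail: the noise `z` is not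
too large, `K` approximates `x` within `τ`, and an element of `K` at distance at least `d` from `x`
explains the observation `a x + z` as well as every element of `K` within `τ` of `x` does.
Quantifying over all near elements, instead of naming the one chosen by an encoder, makes this set
measurable, although encoders need not be. -/
def failureSet {m n : ℕ} (K : Finset (EuclideanSpace ℝ (Fin n))) (τ σ d : ℝ) :
    Set ((Fin m → Fin n → ℝ) × (EuclideanSpace ℝ (Fin n) × EuclideanSpace ℝ (Fin m))) :=
  {p | ‖p.2.2‖ ≤ √m * σ ∧ (∃ c₀ ∈ K, ‖p.2.1 - c₀‖ ≤ τ) ∧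
    ∃ c ∈ K, d ≤ ‖p.2.1 - c‖ ∧ ∀ c₀ ∈ K, ‖p.2.1 - c₀‖ ≤ τ →
      ‖Matrix.toEuclideanLin (Matrix.of p.1) (p.2.1 - c) + p.2.2‖ ≤
        ‖Matrix.toEuclideanLin (Matrix.of p.1) (p.2.1 - c₀) + p.2.2‖}

theorem measurableSet_failureSet {m n : ℕ} (K : Finset (EuclideanSpace ℝ (Fin n))) (τ σ d : ℝ) :
    MeasurableSet (failureSet (m := m) K τ σ d) := by
  have hmeas : ∀ c : EuclideanSpace ℝ (Fin n), Measurable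
      fun p : (Fin m → Fin n → ℝ) × (EuclideanSpace ℝ (Fin n) × EuclideanSpace ℝ (Fin m)) =>
        ‖Matrix.toEuclideanLin (Matrix.of p.1) (p.2.1 - c) + p.2.2‖ := by
    intro c
    have hw : Measurable
        fun p : (Fin m → Fin n → ℝ) × (EuclideanSpace ℝ (Fin n) × EuclideanSpace ℝ (Fin m)) =>
          p.2.1 - c := by fun_prop
    have hlin := measurable_toEuclideanLin_of (measurable_fst (α := Fin m → Fin n → ℝ)) hw
    fun_prop
  have hdist : ∀ c : EuclideanSpace ℝ (Fin n), Measurable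
      fun p : (Fin m → Fin n → ℝ) × (EuclideanSpace ℝ (Fin n) × EuclideanSpace ℝ (Fin m)) =>
        ‖p.2.1 - c‖ := fun c => by fun_prop
  have hnoise : Measurable
      fun p : (Fin m → Fin n → ℝ) × (EuclideanSpace ℝ (Fin n) × EuclideanSpace ℝ (Fin m)) =>
        ‖p.2.2‖ := by fun_prop
  have heq : failureSet (m := m) K τ σ d = {p | ‖p.2.2‖ ≤ √m * σ} ∩
      ((⋃ c₀ ∈ K, {p | ‖p.2.1 - c₀‖ ≤ τ}) ∩
      ⋃ c ∈ K, ({p | d ≤ ‖p.2.1 - c‖} ∩ ⋂ c₀ ∈ K, ({p | ‖p.2.1 - c₀‖ ≤ τ}ᶜ ∪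
        {p | ‖Matrix.toEuclideanLin (Matrix.of p.1) (p.2.1 - c) + p.2.2‖ ≤
          ‖Matrix.toEuclideanLin (Matrix.of p.1) (p.2.1 - c₀) + p.2.2‖}))) := by
    ext p
    simp only [failureSet, imp_iff_not_or, Set.mem_ofPred_eq, Set.mem_inter_iff, Set.mem_iUnion,
      Set.mem_iInter, Set.mem_union, Set.mem_compl_iff, exists_prop]
  rw [heq]
  refine (measurableSet_le hnoise measurable_const).inter (.inter
    (K.measurableSet_biUnion fun c₀ _ => measurableSet_le (hdist c₀) measurable_const)
    (K.measurableSet_biUnion fun c _ => ?_))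
  exact (measurableSet_le measurable_const (hdist c)).inter
    (K.measurableSet_biInter fun c₀ _ =>
      (measurableSet_le (hdist c₀) measurable_const).compl.union
        (measurableSet_le (hmeas c) (hmeas c₀)))

theorem IsStdGaussianMatrix.real_mem_failureSet_le {Ω : Type*} [MeasurableSpace Ω]
    {μ : Measure Ω} [IsProbabilityMeasure μ] {m n : ℕ} (hm : 0 < m)
    {A : Ω → Matrix (Fin m) (Fin n) ℝ} (hA : IsStdGaussianMatrix A μ)
    {X : Ω → EuclideanSpace ℝ (Fin n)} {Z : Ω → EuclideanSpace ℝ (Fin m)}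
    (hX : Measurable X) (hZ : Measurable Z)
    (hAXZ : IndepFun (fun ω (i : Fin m) (j : Fin n) => A ω i j) (fun ω => (X ω, Z ω)) μ)
    (K : Finset (EuclideanSpace ℝ (Fin n))) {τ σ s k : ℝ} (hτ : 0 < τ) (hσ : 0 ≤ σ) (hs : 0 < s)
    (hk : 1 ≤ k) :
    μ.real {ω | ((fun i j => A ω i j), (X ω, Z ω)) ∈ failureSet K τ σ ((2 * τ + 2 * σ) / s)} ≤
      (√k * Real.exp ((1 - k) / 2)) ^ m +
        K.card * ((√(Real.exp 1) * (s * √k / 2)) ^ m / 2) := by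
  have hU : Measurable fun ω (i : Fin m) (j : Fin n) => A ω i j :=
    measurable_pi_lambda _ fun i => measurable_pi_lambda _ fun j => hA.measurable_entry i j
  refine hAXZ.real_mem_le_of_forall hU (hX.prodMk hZ) (measurableSet_failureSet K _ _ _) ?_
  rintro ⟨x, z⟩
  by_cases hxz : ‖z‖ ≤ √m * σ ∧ ∃ c₀ ∈ K, ‖x - c₀‖ ≤ τ
  · obtain ⟨hz, c₀, hc₀, hx⟩ := hxz
    refine le_trans (measureReal_mono ?_) (hA.real_exists_far_le hm K hτ hσ hs hk hx hz)
    rintro ω ⟨-, -, c, hc, hfar, hall⟩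
    exact ⟨c, hc, hfar, hall c₀ hc₀ hx⟩
  · have : {ω | ((fun i j => A ω i j), (x, z)) ∈ failureSet K τ σ ((2 * τ + 2 * σ) / s)} = ∅ :=
      Set.eq_empty_of_forall_notMem fun ω h => hxz ⟨h.1, h.2.1⟩
    rw [this, measureReal_empty]
    positivity

/-! ### The exponents -/

/-- The number of codewords balances the small-ball probabilities, by the choice of `m` and `δ`. -/
theorem two_rpow_mul_sqrt_rpow_pow {n m : ℕ} {R D α η δ : ℝ} (hD0 : 0 < D) (hD1 : D < 1)
    (hη : 1 < η) (hδ : δ = η / Real.logb 2 (1 / D) + α)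
    (hmn : (m : ℝ) = 2 * η * n * R / Real.logb 2 (1 / D)) :
    (2 : ℝ) ^ ((n : ℝ) * R) * √(D ^ ((1 + δ) / η)) ^ m =
      ((2 : ℝ) ^ (-(1 / 2 : ℝ) * n * R * α)) ^ 2 * (√2)⁻¹ ^ m := by
  set L := Real.logb 2 (1 / D) with hL
  have hL0 : 0 < L := Real.logb_pos (by norm_num) ((one_lt_div hD0).2 hD1)
  have hD : D = 2 ^ (-L) := by
    rw [hL, Real.logb_div one_ne_zero hD0.ne', Real.logb_one, zero_sub, neg_neg,
      Real.rpow_logb (by norm_num) (by norm_num) hD0]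
  have hs : √(D ^ ((1 + δ) / η)) ^ m = (2 : ℝ) ^ (-L * ((1 + δ) / η) * (1 / 2) * m) := by
    rw [hD, Real.sqrt_eq_rpow, ← Real.rpow_natCast, ← Real.rpow_mul (by positivity),
      ← Real.rpow_mul (by positivity), ← Real.rpow_mul (by norm_num)]
    ring_nf
  have h2 : (√2)⁻¹ ^ m = (2 : ℝ) ^ (-(1 / 2 : ℝ) * m) := by
    rw [Real.sqrt_eq_rpow, ← Real.rpow_neg (by norm_num), ← Real.rpow_natCast,
      ← Real.rpow_mul (by norm_num)]
  rw [hs, h2, ← Real.rpow_natCast, ← Real.rpow_mul (by norm_num), ← Real.rpow_add (by norm_num),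
    ← Real.rpow_add (by norm_num)]
  congr 1
  have hη0 : η ≠ 0 := by positivity
  rw [hmn, hδ]
  push_cast
  field_simp
  ring

/-- Whatever the size of `b`, one of the cut-offs `k = 4` and `k = 2` makes the sum of the tail
bound and the small-ball bound at most `b + exp (-m / 2)`. -/
theorem exists_cutoff (m : ℕ) {b : ℝ} (hb0 : 0 < b) (hb1 : b ≤ 1) :
    ∃ k : ℝ, 1 ≤ k ∧ (√k * Real.exp ((1 - k) / 2)) ^ m +
      b ^ 2 * (√2)⁻¹ ^ m * ((√(Real.exp 1) * (√k / 2)) ^ m / 2) ≤ b + Real.exp (-(m : ℝ) / 2) := by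
  have he1 := Real.exp_one_gt_d9
  have he2 := Real.exp_one_lt_d9
  have h2 : (0 : ℝ) < √2 := by positivity
  have hexp : √(Real.exp 1) = Real.exp (1 / 2) := (Real.exp_half 1).symm
  have hsq : Real.exp (1 / 2) * Real.exp (1 / 2) = Real.exp 1 := by rw [← Real.exp_add]; norm_num
  have h22 : √2 * √2 = 2 := Real.mul_self_sqrt (by norm_num)
  have hcinv : √2 * Real.exp (-(1 / 2)) * ((√2)⁻¹ * Real.exp (1 / 2)) = 1 := by
    have : Real.exp (-(1 / 2)) * Real.exp (1 / 2) = 1 := by rw [← Real.exp_add]; norm_num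
    field_simp
    linarith
  by_cases hcase : b ≤ 2 * (√2 * Real.exp (-(1 / 2))) ^ m
  · refine ⟨4, by norm_num, ?_⟩
    have h4 : √(4 : ℝ) = 2 := by
      rw [show (4 : ℝ) = 2 ^ 2 by norm_num, Real.sqrt_sq (by norm_num)]
    rw [h4, hexp, add_comm b]
    refine add_le_add ?_ ?_
    · have : 2 * Real.exp ((1 - 4) / 2) ≤ Real.exp (-1 / 2) := by
        have e : Real.exp (-1 / 2) = Real.exp 1 * Real.exp ((1 - 4) / 2) := by
          rw [← Real.exp_add]; norm_num
        rw [e]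
        exact mul_le_mul_of_nonneg_right (by linarith) (Real.exp_pos _).le
      calc _ ≤ Real.exp (-1 / 2) ^ m := pow_le_pow_left₀ (by positivity) this m
        _ = _ := by rw [← Real.exp_nat_mul]; ring_nf
    · calc b ^ 2 * (√2)⁻¹ ^ m * ((Real.exp (1 / 2) * (2 / 2)) ^ m / 2)
          = b * (b / 2) * ((√2)⁻¹ * Real.exp (1 / 2)) ^ m := by rw [mul_pow (√2)⁻¹]; ring
        _ ≤ b * (√2 * Real.exp (-(1 / 2))) ^ m * ((√2)⁻¹ * Real.exp (1 / 2)) ^ m := by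
          gcongr; linarith
        _ = b := by rw [mul_assoc, ← mul_pow, hcinv, one_pow, mul_one]
  · refine ⟨2, by norm_num, ?_⟩
    rw [hexp]
    have ha : (√2 * Real.exp ((1 - 2) / 2)) ^ m ≤ b / 2 := by
      rw [show ((1 : ℝ) - 2) / 2 = -(1 / 2) by norm_num]; linarith
    have hle : (√2)⁻¹ * (Real.exp (1 / 2) * (√2 / 2)) ≤ 1 := by
      have : Real.exp (1 / 2) ≤ 2 := by nlinarith [Real.exp_pos (1 / 2)]
      field_simp
      linarith
    have hball : b ^ 2 * (√2)⁻¹ ^ m * ((Real.exp (1 / 2) * (√2 / 2)) ^ m / 2) ≤ b / 2 := by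
      calc _ = b * b * ((√2)⁻¹ * (Real.exp (1 / 2) * (√2 / 2))) ^ m / 2 := by
            rw [mul_pow (√2)⁻¹]; ring
        _ ≤ b * 1 * 1 / 2 := by gcongr; exact pow_le_one₀ (by positivity) hle
        _ = b / 2 := by ring
    linarith [Real.exp_pos (-(m : ℝ) / 2)]

/-- After multiplication by `√n`, the recovery threshold dominates the distance that
`IsStdGaussianMatrix.real_exists_far_le` requires; its term `√(n / m)` is not needed. -/
theorem scaled_threshold {n m : ℕ} (hn : 0 < n) {D r σ : ℝ} (hD0 : 0 < D) :
    (2 * √(n * D) + 2 * σ) / √(D ^ r) ≤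
      √n * ((2 + √((n : ℝ) / m)) * D ^ ((1 / 2 : ℝ) * (1 - r)) + 2 * σ / √(D ^ r * n)) := by
  have hn' : (0 : ℝ) < n := by exact_mod_cast hn
  have hs : 0 < √(D ^ r) := by positivity
  have h1 : D ^ ((1 / 2 : ℝ) * (1 - r)) = √D / √(D ^ r) := by
    rw [Real.sqrt_eq_rpow, Real.sqrt_eq_rpow, ← Real.rpow_mul hD0.le, ← Real.rpow_sub hD0]
    ring_nf
  rw [h1, Real.sqrt_mul hn'.le, Real.sqrt_mul (by positivity)]
  have hsn : 0 < √(n : ℝ) := by positivity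
  have e : √(n : ℝ) * ((2 + √((n : ℝ) / m)) * (√D / √(D ^ r)) + 2 * σ / (√(D ^ r) * √n)) =
      (2 * (√n * √D) + 2 * σ) / √(D ^ r) + √n * √((n : ℝ) / m) * (√D / √(D ^ r)) := by
    field_simp
    ring
  rw [e]
  exact le_add_of_nonneg_right (by positivity)

/-! ### Recovery by compressible signal pursuit -/

theorem theorem2 {Ω : Type*} [MeasurableSpace Ω] (μ : Measure Ω) [IsProbabilityMeasure μ]
    {m n : ℕ} (hm : 0 < m) (hn : 0 < n)
    (X : Ω → EuclideanSpace ℝ (Fin n)) (Z : Ω → EuclideanSpace ℝ (Fin m))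
    (A : Ω → Matrix (Fin m) (Fin n) ℝ)
    (hX : Measurable X) (hZ : Measurable Z) (hA : IsStdGaussianMatrix A μ)
    (hAXZ : IndepFun (fun ω (i : Fin m) (j : Fin n) => A ω i j) (fun ω => (X ω, Z ω)) μ)
    (Y : Ω → EuclideanSpace ℝ (Fin m))
    (hY : ∀ ω, Y ω = Matrix.toEuclideanLin (A ω) (X ω) + Z ω)
    (σ_m ε_m : ℝ) (hnoise : μ.real {ω | 1 / √(m : ℝ) * ‖Z ω‖ > σ_m} < ε_m)
    (R D ε : ℝ) (hD0 : 0 < D) (hD1 : D < 1)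
    (C : LossyCode n R) (hC : C.AchievesDistortion μ X D ε)
    (α η δ : ℝ) (hα : 0 < α) (hη : 1 < η) (hδ : δ = η / Real.logb 2 (1 / D) + α)
    (hmn : (m : ℝ) = 2 * η * n * R / Real.logb 2 (1 / D))
    (Xtilde : Ω → EuclideanSpace ℝ (Fin n))
    (hXtilde : ∀ ω, C.IsCSPSolution (A ω) (Y ω) (Xtilde ω)) :
    μ.real {ω | 1 / √(n : ℝ) * ‖X ω - Xtilde ω‖ ≥
        (2 + √((n : ℝ) / m)) * D ^ ((1 / 2 : ℝ) * (1 - (1 + δ) / η)) +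
          2 * σ_m / √(D ^ ((1 + δ) / η) * n)} ≤
      ε_m + ε + (2 : ℝ) ^ (-(1 / 2 : ℝ) * n * R * α) + Real.exp (-(m : ℝ) / 2) := by
  have hm' : (0 : ℝ) < m := by exact_mod_cast hm
  have hn' : (0 : ℝ) < n := by exact_mod_cast hn
  have hsm : 0 < √(m : ℝ) := by positivity
  have hsn : 0 < √(n : ℝ) := by positivity
  set b := (2 : ℝ) ^ (-(1 / 2 : ℝ) * n * R * α) with hb
  have hb0 : 0 < b := by positivity
  have hε : 0 ≤ ε := measureReal_nonneg.trans hC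
  rcases lt_or_ge σ_m 0 with hσ | hσ
  · -- A negative noise level is exceeded surely, so that `ε_m` exceeds `1`.
    have huniv : {ω | 1 / √(m : ℝ) * ‖Z ω‖ > σ_m} = Set.univ :=
      Set.eq_univ_of_forall fun ω => lt_of_lt_of_le hσ (by positivity)
    rw [huniv, probReal_univ] at hnoise
    have := measureReal_le_one (μ := μ) (s := {ω | 1 / √(n : ℝ) * ‖X ω - Xtilde ω‖ ≥
        (2 + √((n : ℝ) / m)) * D ^ ((1 / 2 : ℝ) * (1 - (1 + δ) / η)) +
          2 * σ_m / √(D ^ ((1 + δ) / η) * n)})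
    linarith [Real.exp_pos (-(m : ℝ) / 2)]
  have hL0 : 0 < Real.logb 2 (1 / D) := Real.logb_pos (by norm_num) ((one_lt_div hD0).2 hD1)
  have hR : 0 < R := by
    rw [eq_div_iff hL0.ne'] at hmn
    have : 0 < 2 * η * n * R := hmn ▸ mul_pos hm' hL0
    exact pos_of_mul_pos_right this (by positivity)
  have hb1 : b ≤ 1 := by
    refine Real.rpow_le_one_of_one_le_of_nonpos (by norm_num) ?_
    have : 0 < (n : ℝ) * R * α := by positivity
    linarith
  obtain ⟨k, hk, hkb⟩ := exists_cutoff m hb0 hb1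
  set s := √(D ^ ((1 + δ) / η)) with hs
  have hs0 : 0 < s := by positivity
  set τ := √(n * D) with hτ
  have hτ0 : 0 < τ := by positivity
  set K := C.finite_codebook.toFinset with hK
  have hfail := hA.real_mem_failureSet_le hm hX hZ hAXZ K hτ0 hσ hs0 hk
  have hsub : {ω | 1 / √(n : ℝ) * ‖X ω - Xtilde ω‖ ≥
        (2 + √((n : ℝ) / m)) * D ^ ((1 / 2 : ℝ) * (1 - (1 + δ) / η)) +
          2 * σ_m / √(D ^ ((1 + δ) / η) * n)} ⊆
      ({ω | 1 / √(m : ℝ) * ‖Z ω‖ > σ_m} ∪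
        {ω | avgDistortion (X ω) (C.reconstruct (X ω)) > D}) ∪
      {ω | ((fun i j => A ω i j), (X ω, Z ω)) ∈
        failureSet K τ σ_m ((2 * τ + 2 * σ_m) / s)} := by
    intro ω hω
    by_cases hz : 1 / √(m : ℝ) * ‖Z ω‖ > σ_m
    · exact Or.inl (Or.inl hz)
    by_cases hd : avgDistortion (X ω) (C.reconstruct (X ω)) > D
    · exact Or.inl (Or.inr hd)
    refine Or.inr ⟨?_, ⟨C.reconstruct (X ω), ?_, ?_⟩, Xtilde ω, ?_, ?_, fun c₀ hc₀ _ => ?_⟩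
    · rw [not_lt, one_div, inv_mul_le_iff₀ hsm] at hz
      exact hz
    · exact C.finite_codebook.mem_toFinset.2 ⟨X ω, rfl⟩
    · exact norm_sub_le_of_avgDistortion_le hn (not_lt.1 hd)
    · exact C.finite_codebook.mem_toFinset.2 (hXtilde ω).1
    · refine (scaled_threshold (m := m) hn hD0).trans ?_
      calc _ ≤ √n * (1 / √n * ‖X ω - Xtilde ω‖) := mul_le_mul_of_nonneg_left hω hsn.le
        _ = ‖X ω - Xtilde ω‖ := by field_simp
    · have h := (hXtilde ω).2 c₀ (C.finite_codebook.mem_toFinset.1 hc₀)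
      have e : ∀ c, Y ω - Matrix.toEuclideanLin (A ω) c =
          Matrix.toEuclideanLin (A ω) (X ω - c) + Z ω := fun c => by
        rw [hY, map_sub]; abel
      rw [e, e] at h
      exact le_of_sq_le_sq h (norm_nonneg _)
  have hcount : K.card * ((√(Real.exp 1) * (s * √k / 2)) ^ m / 2) ≤
      b ^ 2 * (√2)⁻¹ ^ m * ((√(Real.exp 1) * (√k / 2)) ^ m / 2) := by
    rw [hb, ← two_rpow_mul_sqrt_rpow_pow hD0 hD1 hη hδ hmn, ← hs]
    calc (K.card : ℝ) * ((√(Real.exp 1) * (s * √k / 2)) ^ m / 2)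
        ≤ 2 ^ ((n : ℝ) * R) * ((√(Real.exp 1) * (s * √k / 2)) ^ m / 2) := by
          gcongr; exact C.card_codebook_le
      _ = _ := by
          rw [show √(Real.exp 1) * (s * √k / 2) = s * (√(Real.exp 1) * (√k / 2)) by ring, mul_pow s]
          ring
  have hC' : μ.real {ω | avgDistortion (X ω) (C.reconstruct (X ω)) > D} ≤ ε := hC
  have hu := (measureReal_mono (μ := μ) hsub).trans ((measureReal_union_le _ _).trans
    (add_le_add_left (measureReal_union_le _ _) _))
  linarith
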